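/- Let $d\ge 1$ and let $\mathbb R^d$ carry the Euclidean scalar product $\langle\cdot,\cdot\rangle$, norm $\|\cdot\|$ and closed unit ball $B$. For $K\subset\{1,\dots,d\}$ let $x_K$ be the vector which coincides with $x$ on $K$ and vanishes outside $K$. For $k=0,1,\dots,d$ put $\|x\|_{(k)}^{\mathrm{sgn}}=\sup_{|K|\le k}\|x_K\|$ (so $\|\cdot\|_{(0)}^{\mathrm{sgn}}=0$). For $l=1,\dots,d$ let $\|\cdot\|_{(l)}^{\mathrm{sn}}$ be the $l$-support norm, i.e. the dual norm $\|x\|_{(l)}^{\mathrm{sn}}=\sup\{\langle y,x\rangle : \|y\|_{(l)}^{\mathrm{sgn}}\le 1\}$, and let $B_{(l)}$ be its closed unit ball; put $B_{(0)}=\{0\}$. Let $\mathcal L_0:\mathbb R^d\to[-\infty,+\infty]$ be the Fenchel conjugate $$\mathcal L_0(x)=\sup_{y\in\mathbb R^d}\Bigl(\langle x,y\rangle-\sup_{l=0,1,\dots,d}\bigl(\|y\|_{(l)}^{\mathrm{sgn}}-l\bigr)\Bigr).$$ Then $B_{(0)}\subset B_{(1)}\subset\cdots\subset B_{(d)}=B$,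 and: 1. The epigraph $\mathrm{epi}\,\mathcal L_0=\{(x,t)\in\mathbb R^d\times\mathbb R:\mathcal L_0(x)\le t\}$ is the closed convex hull $$\mathrm{epi}\,\mathcal L_0=\overline{\mathrm{co}}\Bigl(\bigcup_{l=0}^d B_{(l)}\times[l,+\infty)\Bigr).$$ 2. Let $L_0$ be the (well-defined) function on $\mathbb R^d$ with $L_0(0)=0$, $L_0(x)=l$ if $x\in B_{(l)}\setminus B_{(l-1)}$ for $l=1,\dots,d$, and $L_0(x)=+\infty$ if $x\notin B$. Then $\mathcal L_0$ is the largest proper convex lower semicontinuous function $\mathbb R^d\to[-\infty,+\infty]$ that is pointwise $\le L_0$ (in particular $\mathcal L_0$ itself is proper, convex and lower semicontinuous). 3. For every $x\in\mathbb R^d$, $$\mathcal L_0(x)=\min\Bigl\{\sum_{l=1}^d l\,\|x^{(l)}\|_{(l)}^{\mathrm{sn}} \;:\; x^{(1)},\dots,x^{(d)}\in\mathbb R^d,\ \sum_{l=1}^d\|x^{(l)}\|_{(l)}^{\mathrm{sn}}\le 1,\ \sum_{l=1}^d x^{(l)}=x\Bigr\},$$ where the minimum is attained whenever the constraint set is nonempty,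 and equals $+\infty$ when it is empty. -/

import Mathlib

namespace Capra

noncomputable section

/-- Euclidean space `ℝ^d`. -/
abbrev E (d : ℕ) : Type := EuclideanSpace ℝ (Fin d)

/-- `x_K`: the vector that coincides with `x` on `K` and vanishes outside `K`. -/
def restrict {d : ℕ} (K : Finset (Fin d)) (x : E d) : E d :=
  WithLp.toLp 2 (fun i => if i ∈ K then x i else 0)

/-- The `2`-`k`-symmetric gauge norm `sup_{|K| ≤ k} ‖x_K‖`. For `k = 0` only `K = ∅` is allowed
and the value is `0`. -/
def gaugeNorm {d : ℕ} (k : ℕ) (x : E d) : ℝ :=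
  ⨆ K : {K : Finset (Fin d) // K.card ≤ k}, ‖restrict K.1 x‖

/-- The `k`-support norm (`1 ≤ k ≤ d`): the dual norm of the `2`-`k`-symmetric gauge norm. -/
def supportNorm {d : ℕ} (k : ℕ) (x : E d) : ℝ :=
  sSup ((fun y : E d => inner ℝ y x) '' {y : E d | gaugeNorm k y ≤ 1})

/-- The unit ball of the `l`-support norm, with the convention that it is `{0}` for `l = 0`. -/
def supportBall (d : ℕ) (l : ℕ) : Set (E d) :=
  if l = 0 then {0} else {x | supportNorm l x ≤ 1}

/-- The Fenchel conjugate on `ℝ^d` (in `EReal`, `⊥ + ⊤ = ⊥`, which is the lower addition). -/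
def fenchelConjugate {d : ℕ} (g : E d → EReal) (x : E d) : EReal :=
  ⨆ y : E d, ((inner ℝ x y : ℝ) : EReal) + (-g y)

/-- `𝓛₀`, the Fenchel conjugate of `y ↦ sup_{l = 0, …, d} (gaugeNorm l y - l)`. -/
def calL0 (d : ℕ) : E d → EReal :=
  fenchelConjugate (fun y => ⨆ l : Fin (d + 1), ((gaugeNorm (l : ℕ) y - (l : ℕ) : ℝ) : EReal))

/-- Epigraph of an extended-real-valued function. -/
def epigraph {X : Type*} (f : X → EReal) : Set (X × ℝ) :=
  {p | f p.1 ≤ (p.2 : EReal)}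

/-- Proper: never `-∞`, and somewhere `< +∞`. -/
def IsProper {X : Type*} (f : X → EReal) : Prop :=
  (∀ x, ⊥ < f x) ∧ ∃ x, f x < ⊤

/-- Proper, convex (i.e. with convex epigraph) and lower semicontinuous. -/
def IsProperConvexLsc {d : ℕ} (f : E d → EReal) : Prop :=
  IsProper f ∧ Convex ℝ (epigraph f) ∧ LowerSemicontinuous f

open Classical in
/-- The step function `L₀`: `0` at `0`, `l` on `B_(l) ∖ B_(l-1)` for `l = 1, …, d`, and `+∞`
elsewhere. -/
def stepL0 (d : ℕ) (x : E d) : EReal :=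
  if x = 0 then 0
  else if h : ∃ l : ℕ, 1 ≤ l ∧ l ≤ d ∧ x ∈ supportBall d l \ supportBall d (l - 1) then
    ((Nat.find h : ℝ) : EReal)
  else ⊤

/-- Families `x^(1), …, x^(d)` with `∑ ‖x^(l)‖_(l) ≤ 1` and `∑ x^(l) = x`; the entry of index
`i : Fin d` is `x^(i+1)`. -/
def decompositions {d : ℕ} (x : E d) : Set (Fin d → E d) :=
  {z | ∑ i : Fin d, supportNorm ((i : ℕ) + 1) (z i) ≤ 1 ∧ ∑ i : Fin d, z i = x}

/-- The cost `∑ l ‖x^(l)‖_(l)` of a family `x^(1), …, x^(d)`. -/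
def cost {d : ℕ} (z : Fin d → E d) : ℝ :=
  ∑ i : Fin d, ((i : ℕ) + 1 : ℝ) * supportNorm ((i : ℕ) + 1) (z i)

end

end Capra

namespace Capra

variable {d : ℕ}

/-! Everything follows from the equality of three subsets of `E d × ℝ`: the epigraph of `calL0`, the
closed convex hull of `cylinders`, and `decompositionEpigraph`, proved by a cycle of inclusions.

Epigraph in hull: `gaugeNorm l` is the support function of the ball `supportBall d l`, so a
hyperplane strictly separating a point from the hull, rescaled to slope -1, violates an inequality
defining the conjugate. Hull in decompositions: that set contains the cylinders, is convex by
sublinearity of the norms, and is closed because the admissible families form a compact set.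
Decompositions in epigraph: generalized Cauchy–Schwarz combined with `gaugeNorm l y ≤ penalizedGauge
y + l`.

The attained minimum and the maximality of `calL0` are then read off from epigraphs. -/

theorem inner_restrict_left (K : Finset (Fin d)) (x y : E d) :
    inner ℝ (restrict K x) y = inner ℝ x (restrict K y) := by
  simp only [PiLp.inner_apply, restrict]
  refine Finset.sum_congr rfl fun i _ => ?_
  by_cases h : i ∈ K <;> simp [h]

theorem restrict_restrict (K : Finset (Fin d)) (x : E d) :
    restrict K (restrict K x) = restrict K x := by
  ext i
  by_cases h : i ∈ K <;> simp [restrict, h]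

theorem inner_restrict_self (K : Finset (Fin d)) (x : E d) :
    inner ℝ x (restrict K x) = ‖restrict K x‖ ^ 2 := by
  rw [← real_inner_self_eq_norm_sq, inner_restrict_left, restrict_restrict]

theorem norm_restrict_le (K : Finset (Fin d)) (x : E d) : ‖restrict K x‖ ≤ ‖x‖ := by
  have h := real_inner_le_norm x (restrict K x)
  rw [inner_restrict_self] at h
  by_contra! hlt
  nlinarith [norm_nonneg x, norm_nonneg (restrict K x)]

theorem restrict_smul (K : Finset (Fin d)) (c : ℝ) (x : E d) :
    restrict K (c • x) = c • restrict K x := by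
  ext i
  by_cases h : i ∈ K <;> simp [restrict, h]

theorem restrict_univ (x : E d) : restrict Finset.univ x = x := by
  ext i
  simp [restrict]

/-! ### Gauge norms -/

theorem norm_restrict_le_gaugeNorm {k : ℕ} {K : Finset (Fin d)} (hK : K.card ≤ k) (x : E d) :
    ‖restrict K x‖ ≤ gaugeNorm k x :=
  le_ciSup (f := fun K : {K : Finset (Fin d) // K.card ≤ k} => ‖restrict K.1 x‖)
    (Set.finite_range _).bddAbove ⟨K, hK⟩

theorem gaugeNorm_le {k : ℕ} {x : E d} {c : ℝ}
    (h : ∀ K : Finset (Fin d), K.card ≤ k → ‖restrict K x‖ ≤ c) : gaugeNorm k x ≤ c := by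
  have : Nonempty {K : Finset (Fin d) // K.card ≤ k} := ⟨⟨∅, by simp⟩⟩
  exact ciSup_le fun K => h K.1 K.2

theorem gaugeNorm_nonneg (k : ℕ) (x : E d) : 0 ≤ gaugeNorm k x :=
  (norm_nonneg _).trans (norm_restrict_le_gaugeNorm (K := ∅) (by simp) x)

theorem gaugeNorm_le_norm (k : ℕ) (x : E d) : gaugeNorm k x ≤ ‖x‖ :=
  gaugeNorm_le fun K _ => norm_restrict_le K x

theorem gaugeNorm_zero_left (x : E d) : gaugeNorm 0 x = 0 := by
  refine le_antisymm (gaugeNorm_le fun K hK => ?_) (gaugeNorm_nonneg 0 x)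
  obtain rfl : K = ∅ := by simpa using hK
  have : restrict (∅ : Finset (Fin d)) x = 0 := by ext i; simp [restrict]
  simp [this]

theorem gaugeNorm_self (x : E d) : gaugeNorm d x = ‖x‖ := by
  refine le_antisymm (gaugeNorm_le_norm d x) ?_
  simpa [restrict_univ] using norm_restrict_le_gaugeNorm (K := Finset.univ) (k := d) (by simp) x

theorem gaugeNorm_mono {k l : ℕ} (h : k ≤ l) (x : E d) : gaugeNorm k x ≤ gaugeNorm l x :=
  gaugeNorm_le fun _ hK => norm_restrict_le_gaugeNorm (hK.trans h) x

theorem gaugeNorm_smul_le (k : ℕ) {c : ℝ} (hc : 0 ≤ c) (x : E d) :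
    gaugeNorm k (c • x) ≤ c * gaugeNorm k x := by
  refine gaugeNorm_le fun K hK => ?_
  rw [restrict_smul, norm_smul, Real.norm_of_nonneg hc]
  exact mul_le_mul_of_nonneg_left (norm_restrict_le_gaugeNorm hK x) hc

theorem abs_apply_le_gaugeNorm {k : ℕ} (hk : 1 ≤ k) (x : E d) (i : Fin d) :
    |x i| ≤ gaugeNorm k x := by
  have h := norm_restrict_le_gaugeNorm (K := {i}) (k := k) (by simpa using hk) x
  have h' := PiLp.norm_apply_le (restrict {i} x) i
  have hi : (restrict {i} x) i = x i := by simp [restrict]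
  rw [hi, Real.norm_eq_abs] at h'
  exact h'.trans h

/-- Singletons `K = {i}` bound each coordinate of `y`. This makes the supremum in `supportNorm`
finite; for `k = 0` the set would be unbounded and `sSup` would default to 0. -/
theorem inner_le_sum_abs {k : ℕ} (hk : 1 ≤ k) {y : E d} (hy : gaugeNorm k y ≤ 1) (x : E d) :
    inner ℝ y x ≤ ∑ i, |x i| := by
  rw [PiLp.inner_apply]
  refine Finset.sum_le_sum fun i _ => ?_
  have h := (abs_apply_le_gaugeNorm hk y i).trans hy
  have h2 : inner ℝ (y i) (x i) = x i * y i := by simp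
  rw [h2]
  calc x i * y i ≤ |x i * y i| := le_abs_self _
    _ = |x i| * |y i| := abs_mul _ _
    _ ≤ |x i| * 1 := mul_le_mul_of_nonneg_left h (abs_nonneg _)
    _ = |x i| := mul_one _

/-! ### Support norms and duality -/

theorem inner_le_supportNorm {k : ℕ} (hk : 1 ≤ k) {y : E d} (hy : gaugeNorm k y ≤ 1) (x : E d) :
    inner ℝ y x ≤ supportNorm k x := by
  refine le_csSup ⟨∑ i, |x i|, ?_⟩ ⟨y, hy, rfl⟩
  rintro _ ⟨z, hz, rfl⟩
  exact inner_le_sum_abs hk hz x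

theorem gaugeNorm_zero_right (k : ℕ) : gaugeNorm k (0 : E d) = 0 :=
  le_antisymm (by simpa using gaugeNorm_le_norm k (0 : E d)) (gaugeNorm_nonneg k 0)

theorem supportNorm_le {k : ℕ} {x : E d} {c : ℝ}
    (h : ∀ y : E d, gaugeNorm k y ≤ 1 → inner ℝ y x ≤ c) : supportNorm k x ≤ c := by
  refine csSup_le ⟨_, 0, ?_, rfl⟩ ?_
  · simp [gaugeNorm_zero_right]
  · rintro _ ⟨y, hy, rfl⟩
    exact h y hy

theorem supportNorm_le_sum_abs {k : ℕ} (hk : 1 ≤ k) (x : E d) :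
    supportNorm k x ≤ ∑ i, |x i| :=
  supportNorm_le fun _ hy => inner_le_sum_abs hk hy x

theorem supportNorm_add_le {k : ℕ} (hk : 1 ≤ k) (x y : E d) :
    supportNorm k (x + y) ≤ supportNorm k x + supportNorm k y := by
  refine supportNorm_le fun z hz => ?_
  rw [inner_add_right]
  exact add_le_add (inner_le_supportNorm hk hz x) (inner_le_supportNorm hk hz y)

theorem supportNorm_smul_le {k : ℕ} (hk : 1 ≤ k) {c : ℝ} (hc : 0 ≤ c) (x : E d) :
    supportNorm k (c • x) ≤ c * supportNorm k x := by
  refine supportNorm_le fun z hz => ?_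
  rw [real_inner_smul_right]
  exact mul_le_mul_of_nonneg_left (inner_le_supportNorm hk hz x) hc

theorem supportNorm_zero (k : ℕ) : supportNorm k (0 : E d) = 0 := by
  refine le_antisymm (supportNorm_le fun y _ => by simp) ?_
  refine le_csSup ⟨0, ?_⟩ ⟨0, ?_, by simp⟩
  · rintro _ ⟨y, -, rfl⟩
    simp
  · simp [gaugeNorm_zero_right]

theorem norm_le_supportNorm {k : ℕ} (hk : 1 ≤ k) (x : E d) : ‖x‖ ≤ supportNorm k x := by
  rcases eq_or_ne x 0 with rfl | hx
  · simp [supportNorm_zero]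
  have hn : ‖x‖ ≠ 0 := norm_ne_zero_iff.2 hx
  have h : gaugeNorm k (‖x‖⁻¹ • x) ≤ 1 := by
    refine (gaugeNorm_le_norm _ _).trans ?_
    rw [norm_smul, norm_inv, norm_norm, inv_mul_cancel₀ hn]
  have h' := inner_le_supportNorm hk h x
  rwa [real_inner_smul_left, real_inner_self_eq_norm_sq, pow_two, inv_mul_cancel_left₀ hn] at h'

theorem supportNorm_nonneg {k : ℕ} (hk : 1 ≤ k) (x : E d) : 0 ≤ supportNorm k x :=
  (norm_nonneg x).trans (norm_le_supportNorm hk x)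

theorem supportNorm_anti {k l : ℕ} (hk : 1 ≤ k) (h : k ≤ l) (x : E d) :
    supportNorm l x ≤ supportNorm k x :=
  supportNorm_le fun y hy => inner_le_supportNorm hk ((gaugeNorm_mono h y).trans hy) x

theorem continuous_supportNorm {k : ℕ} (hk : 1 ≤ k) :
    Continuous (supportNorm k : E d → ℝ) := by
  have hsub (x y : E d) : supportNorm k x - supportNorm k y ≤ ∑ i, |x i - y i| := by
    have h := supportNorm_add_le hk y (x - y)
    have h' := supportNorm_le_sum_abs hk (x - y)
    simp only [PiLp.sub_apply] at h'
    rw [add_sub_cancel] at h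
    linarith
  refine continuous_iff_continuousAt.2 fun x => ?_
  rw [ContinuousAt, tendsto_iff_dist_tendsto_zero]
  have hlim : Filter.Tendsto (fun y : E d => ∑ i, |y i - x i|) (nhds x) (nhds 0) := by
    have hc : Continuous fun y : E d => ∑ i, |y i - x i| := by fun_prop
    simpa using hc.tendsto x
  refine squeeze_zero (fun _ => dist_nonneg) (fun y => ?_) hlim
  rw [Real.dist_eq, abs_le]
  have h := hsub x y
  simp only [abs_sub_comm (x _)] at h
  exact ⟨by linarith, hsub y x⟩

/-- The generalized Cauchy–Schwarz inequality for the dual pair of norms. -/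
theorem inner_le_gaugeNorm_mul_supportNorm {k : ℕ} (hk : 1 ≤ k) (x y : E d) :
    inner ℝ x y ≤ gaugeNorm k y * supportNorm k x := by
  rcases (gaugeNorm_nonneg k y).eq_or_lt with h | h
  · have hy : y = 0 := by
      ext i
      have := abs_apply_le_gaugeNorm hk y i
      rw [← h] at this
      simpa using this
    simp [hy, gaugeNorm_zero_right]
  · have h1 : gaugeNorm k ((gaugeNorm k y)⁻¹ • y) ≤ 1 := by
      refine (gaugeNorm_smul_le k (inv_nonneg.2 h.le) y).trans ?_
      rw [inv_mul_cancel₀ h.ne']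
    have h2 := inner_le_supportNorm hk h1 x
    rw [real_inner_smul_left, inv_mul_le_iff₀ h, real_inner_comm] at h2
    exact h2

/-! ### Unit balls of the support norms -/

theorem zero_mem_supportBall (l : ℕ) : (0 : E d) ∈ supportBall d l := by
  unfold supportBall
  split_ifs
  · rfl
  · simp [supportNorm_zero]

theorem mem_supportBall {l : ℕ} (hl : 1 ≤ l) {x : E d} :
    x ∈ supportBall d l ↔ supportNorm l x ≤ 1 := by
  simp [supportBall, Nat.one_le_iff_ne_zero.1 hl]

theorem supportBall_mono {k l : ℕ} (h : k ≤ l) : supportBall d k ⊆ supportBall d l := by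
  intro x hx
  rcases Nat.eq_zero_or_pos k with rfl | hk
  · obtain rfl : x = 0 := by simpa [supportBall] using hx
    exact zero_mem_supportBall l
  · rw [mem_supportBall hk] at hx
    rw [mem_supportBall (hk.trans_le h)]
    exact (supportNorm_anti hk h x).trans hx

theorem supportNorm_self (hd : 1 ≤ d) (x : E d) : supportNorm d x = ‖x‖ := by
  refine le_antisymm (supportNorm_le fun y hy => ?_) (norm_le_supportNorm hd x)
  rw [gaugeNorm_self] at hy
  exact (real_inner_le_norm y x).trans (mul_le_of_le_one_left (norm_nonneg x) hy)

theorem supportBall_self (hd : 1 ≤ d) : supportBall d d = Metric.closedBall (0 : E d) 1 := by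
  ext x
  rw [mem_supportBall hd, supportNorm_self hd, mem_closedBall_zero_iff]

/-- The gauge norm is attained as the support function of the unit ball of the support norm. -/
theorem exists_mem_supportBall_inner_eq_gaugeNorm (l : ℕ) (y : E d) :
    ∃ x ∈ supportBall d l, inner ℝ x y = gaugeNorm l y := by
  rcases Nat.eq_zero_or_pos l with rfl | hl
  · exact ⟨0, zero_mem_supportBall 0, by simp [gaugeNorm_zero_left]⟩
  have : Nonempty {K : Finset (Fin d) // K.card ≤ l} := ⟨⟨∅, by simp⟩⟩
  obtain ⟨⟨K, hK⟩, hKy⟩ : ∃ K : {K : Finset (Fin d) // K.card ≤ l},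
      ‖restrict K.1 y‖ = gaugeNorm l y := exists_eq_ciSup_of_finite
  -- Normalize the restriction of `y` to an optimal `K`. If it vanishes, the inverse is 0 and so is
  -- the gauge norm.
  refine ⟨‖restrict K y‖⁻¹ • restrict K y, ?_, ?_⟩
  · rw [mem_supportBall hl]
    refine supportNorm_le fun z hz => ?_
    have h0 : inner ℝ z (restrict K y) = inner ℝ (restrict K z) (restrict K y) := by
      rw [inner_restrict_left, restrict_restrict]
    rw [real_inner_smul_right, h0]
    have h1 := real_inner_le_norm (restrict K z) (restrict K y)
    have h2 := (norm_restrict_le_gaugeNorm hK z).trans hz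
    rcases (norm_nonneg (restrict K y)).eq_or_lt with h | h
    · simp [← h]
    · rw [inv_mul_le_iff₀ h, mul_one]
      exact h1.trans (mul_le_of_le_one_left h.le h2)
  · rw [← hKy, real_inner_smul_left, real_inner_comm, inner_restrict_self]
    rcases eq_or_ne ‖restrict K y‖ 0 with h | h
    · simp [h]
    · rw [pow_two, inv_mul_cancel_left₀ h]

/-! ### The conjugated function and its conjugate -/

/-- `sup_{l = 0, …, d} (gaugeNorm l y - l)`, as a real number. -/
noncomputable def penalizedGauge (y : E d) : ℝ :=
  ⨆ l : Fin (d + 1), (gaugeNorm (l : ℕ) y - (l : ℕ))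

theorem sub_le_penalizedGauge {l : ℕ} (hl : l ≤ d) (y : E d) :
    gaugeNorm l y - l ≤ penalizedGauge y :=
  le_ciSup (f := fun l : Fin (d + 1) => gaugeNorm (l : ℕ) y - (l : ℕ))
    (Set.finite_range _).bddAbove ⟨l, Nat.lt_succ_of_le hl⟩

theorem penalizedGauge_le {y : E d} {c : ℝ} (h : ∀ l ≤ d, gaugeNorm l y - l ≤ c) :
    penalizedGauge y ≤ c :=
  ciSup_le fun l => h l (Nat.le_of_lt_succ l.2)

theorem penalizedGauge_nonneg (y : E d) : 0 ≤ penalizedGauge y := by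
  simpa [gaugeNorm_zero_left] using sub_le_penalizedGauge (Nat.zero_le d) y

theorem penalizedGauge_le_norm (y : E d) : penalizedGauge y ≤ ‖y‖ :=
  penalizedGauge_le fun l _ => by
    have := gaugeNorm_le_norm l y
    have : (0 : ℝ) ≤ l := l.cast_nonneg
    linarith

theorem coe_penalizedGauge (y : E d) :
    (penalizedGauge y : EReal) =
      ⨆ l : Fin (d + 1), ((gaugeNorm (l : ℕ) y - (l : ℕ) : ℝ) : EReal) := by
  refine le_antisymm ?_ (iSup_le fun l => ?_)
  · obtain ⟨l, hl⟩ : ∃ l : Fin (d + 1), gaugeNorm (l : ℕ) y - (l : ℕ) = penalizedGauge y :=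
      exists_eq_ciSup_of_finite
    rw [← hl]
    exact le_iSup (fun l : Fin (d + 1) => ((gaugeNorm (l : ℕ) y - (l : ℕ) : ℝ) : EReal)) l
  · exact EReal.coe_le_coe_iff.2 (sub_le_penalizedGauge (Nat.le_of_lt_succ l.2) y)

theorem calL0_eq (x : E d) :
    calL0 d x = ⨆ y : E d, ((inner ℝ x y - penalizedGauge y : ℝ) : EReal) := by
  unfold calL0 fenchelConjugate
  refine iSup_congr fun y => ?_
  beta_reduce
  rw [← coe_penalizedGauge, EReal.coe_sub, sub_eq_add_neg]

theorem calL0_le_coe_iff {x : E d} {t : ℝ} :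
    calL0 d x ≤ t ↔ ∀ y : E d, inner ℝ x y - penalizedGauge y ≤ t := by
  simp only [calL0_eq, iSup_le_iff, EReal.coe_le_coe_iff]

theorem calL0_nonneg (x : E d) : 0 ≤ calL0 d x := by
  rw [calL0_eq]
  refine le_trans ?_ (le_iSup _ (0 : E d))
  have h : penalizedGauge (0 : E d) = 0 :=
    le_antisymm (by simpa using penalizedGauge_le_norm (0 : E d)) (penalizedGauge_nonneg 0)
  simp [h]

theorem lowerSemicontinuous_calL0 : LowerSemicontinuous (calL0 d) := by
  have : calL0 d = fun x => ⨆ y : E d, ((inner ℝ x y - penalizedGauge y : ℝ) : EReal) :=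
    funext calL0_eq
  rw [this]
  refine lowerSemicontinuous_iSup fun y => Continuous.lowerSemicontinuous ?_
  exact continuous_coe_real_ereal.comp (by fun_prop)

/-! ### Cylinders and decompositions -/

/-- The union of the cylinders `B_(l) × [l, +∞)`. -/
def cylinders (d : ℕ) : Set (E d × ℝ) :=
  ⋃ l : Fin (d + 1), supportBall d (l : ℕ) ×ˢ Set.Ici (((l : ℕ) : ℝ))

theorem mem_cylinders {l : ℕ} (hl : l ≤ d) {x : E d} (hx : x ∈ supportBall d l) {t : ℝ}
    (ht : (l : ℝ) ≤ t) : (x, t) ∈ cylinders d :=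
  Set.mem_iUnion.2 ⟨⟨l, Nat.lt_succ_of_le hl⟩, hx, ht⟩

/-- The set of `(x, t)` for which `x` has a decomposition of cost at most `t`. -/
def decompositionEpigraph (d : ℕ) : Set (E d × ℝ) :=
  {p | ∃ z ∈ decompositions p.1, cost z ≤ p.2}

theorem continuous_cost : Continuous (cost : (Fin d → E d) → ℝ) :=
  continuous_finsetSum _ fun i _ => continuous_const.mul
    ((continuous_supportNorm (by simp)).comp (continuous_apply i))

theorem continuous_sum_supportNorm :
    Continuous fun z : Fin d → E d => ∑ i : Fin d, supportNorm ((i : ℕ) + 1) (z i) :=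
  continuous_finsetSum _ fun i _ => (continuous_supportNorm (by simp)).comp (continuous_apply i)

theorem isCompact_sum_supportNorm_le_one :
    IsCompact {z : Fin d → E d | ∑ i : Fin d, supportNorm ((i : ℕ) + 1) (z i) ≤ 1} := by
  refine (isCompact_closedBall (0 : Fin d → E d) 1).of_isClosed_subset
    (isClosed_le continuous_sum_supportNorm continuous_const) fun z hz => ?_
  rw [mem_closedBall_zero_iff, pi_norm_le_iff_of_nonneg zero_le_one]
  intro i
  refine (norm_le_supportNorm (k := (i : ℕ) + 1) (by simp) (z i)).trans (le_trans ?_ hz)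
  exact Finset.single_le_sum (f := fun i : Fin d => supportNorm ((i : ℕ) + 1) (z i))
    (fun j _ => supportNorm_nonneg (by simp) _) (Finset.mem_univ i)

/-- Projection along a compact factor is a closed map, here applied to the closed relation between
families and pairs `(x, t)`. -/
theorem isClosed_decompositionEpigraph : IsClosed (decompositionEpigraph d) := by
  set D := {z : Fin d → E d | ∑ i : Fin d, supportNorm ((i : ℕ) + 1) (z i) ≤ 1} with hD
  have : CompactSpace D := isCompact_iff_compactSpace.1 isCompact_sum_supportNorm_le_one
  have hF : IsClosed {q : D × (E d × ℝ) | ∑ i, q.1.1 i = q.2.1 ∧ cost q.1.1 ≤ q.2.2} := by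
    refine IsClosed.inter (isClosed_eq (by fun_prop) (by fun_prop))
      (isClosed_le (continuous_cost.comp (continuous_subtype_val.comp continuous_fst))
        (continuous_snd.comp continuous_snd))
  convert isClosedMap_snd_of_compactSpace _ hF using 1
  ext p
  constructor
  · rintro ⟨z, ⟨hz, hs⟩, hc⟩
    exact ⟨(⟨z, hz⟩, p), ⟨hs, hc⟩, rfl⟩
  · rintro ⟨⟨⟨z, hz⟩, p⟩, ⟨hs, hc⟩, rfl⟩
    exact ⟨z, ⟨hz, hs⟩, hc⟩

theorem convex_decompositionEpigraph : Convex ℝ (decompositionEpigraph d) := by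
  rintro ⟨x, s⟩ ⟨z, ⟨hz, hzx⟩, hzs⟩ ⟨y, t⟩ ⟨w, ⟨hw, hwy⟩, hwt⟩ a b ha hb hab
  dsimp only at hzx hzs hwy hwt
  have key (i : Fin d) : supportNorm ((i : ℕ) + 1) (a • z i + b • w i) ≤
      a * supportNorm ((i : ℕ) + 1) (z i) + b * supportNorm ((i : ℕ) + 1) (w i) :=
    (supportNorm_add_le (by simp) _ _).trans
      (add_le_add (supportNorm_smul_le (by simp) ha _) (supportNorm_smul_le (by simp) hb _))
  refine ⟨fun i => a • z i + b • w i, ⟨?_, ?_⟩, ?_⟩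
  · refine (Finset.sum_le_sum fun i _ => key i).trans ?_
    rw [Finset.sum_add_distrib, ← Finset.mul_sum, ← Finset.mul_sum]
    nlinarith
  · simp [Finset.sum_add_distrib, ← Finset.smul_sum, hzx, hwy]
  · calc cost (fun i => a • z i + b • w i)
        ≤ ∑ i : Fin d, ((i : ℕ) + 1 : ℝ) * (a * supportNorm ((i : ℕ) + 1) (z i) +
            b * supportNorm ((i : ℕ) + 1) (w i)) :=
          Finset.sum_le_sum fun i _ => mul_le_mul_of_nonneg_left (key i) (by positivity)
      _ = a * cost z + b * cost w := by
          simp only [cost, Finset.mul_sum, ← Finset.sum_add_distrib]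
          exact Finset.sum_congr rfl fun i _ => by ring
      _ ≤ a * s + b * t :=
          add_le_add (mul_le_mul_of_nonneg_left hzs ha) (mul_le_mul_of_nonneg_left hwt hb)

theorem cylinders_subset_decompositionEpigraph : cylinders d ⊆ decompositionEpigraph d := by
  rintro ⟨x, t⟩ hp
  obtain ⟨⟨l, hl⟩, hx, ht⟩ := Set.mem_iUnion.1 hp
  dsimp only at hx ht
  rw [Set.mem_Ici] at ht
  rcases Nat.eq_zero_or_pos l with rfl | hpos
  · obtain rfl : x = 0 := by simpa [supportBall] using hx
    exact ⟨fun _ => 0, ⟨by simp [supportNorm_zero], by simp⟩,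
      by simpa [cost, supportNorm_zero] using ht⟩
  · rw [mem_supportBall hpos] at hx
    obtain ⟨k, rfl⟩ : ∃ k, l = k + 1 := ⟨l - 1, by omega⟩
    -- Slot `k` carries the norm of index `k + 1 = l`; the family puts all of `x` there.
    let j : Fin d := ⟨k, by omega⟩
    have hne (i : Fin d) (hi : i ≠ j) :
        supportNorm ((i : ℕ) + 1) ((Pi.single j x : Fin d → E d) i) = 0 := by
      rw [Pi.single_eq_of_ne hi, supportNorm_zero]
    refine ⟨Pi.single j x, ⟨?_, ?_⟩, ?_⟩
    · rw [Fintype.sum_eq_single j hne, Pi.single_eq_same]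
      exact hx
    · rw [Fintype.sum_eq_single j fun i hi => by rw [Pi.single_eq_of_ne hi], Pi.single_eq_same]
    · unfold cost
      rw [Fintype.sum_eq_single j fun i hi => by rw [hne i hi, mul_zero], Pi.single_eq_same]
      refine (mul_le_of_le_one_right (by positivity) hx).trans ?_
      simpa [j] using ht

/-! ### The cycle of inclusions -/

theorem decompositionEpigraph_subset_epigraph :
    decompositionEpigraph d ⊆ epigraph (calL0 d) := by
  rintro ⟨x, t⟩ ⟨z, ⟨hz, hzx⟩, hzt⟩
  dsimp only at hzx hzt
  refine calL0_le_coe_iff.2 fun y => ?_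
  have hterm (i : Fin d) : inner ℝ (z i) y ≤
      penalizedGauge y * supportNorm ((i : ℕ) + 1) (z i) +
        ((i : ℕ) + 1 : ℝ) * supportNorm ((i : ℕ) + 1) (z i) := by
    refine (inner_le_gaugeNorm_mul_supportNorm (k := (i : ℕ) + 1) (by simp) (z i) y).trans ?_
    rw [← add_mul]
    refine mul_le_mul_of_nonneg_right ?_ (supportNorm_nonneg (by simp) _)
    have h := sub_le_penalizedGauge (l := (i : ℕ) + 1) i.2 y
    push_cast at h
    linarith
  have hsum : inner ℝ x y ≤
      penalizedGauge y * (∑ i : Fin d, supportNorm ((i : ℕ) + 1) (z i)) + cost z := by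
    rw [← hzx, sum_inner, Finset.mul_sum, cost, ← Finset.sum_add_distrib]
    exact Finset.sum_le_sum fun i _ => hterm i
  -- Since `penalizedGauge y` is nonnegative, its factor, a sum at most 1, can be dropped.
  have := mul_le_of_le_one_right (penalizedGauge_nonneg y) hz
  linarith

theorem epigraph_calL0_subset_closedConvexHull :
    epigraph (calL0 d) ⊆ closedConvexHull ℝ (cylinders d) := by
  rintro ⟨x, t⟩ hxt
  by_contra hnot
  obtain ⟨f, u, hf, hu⟩ := geometric_hahn_banach_closed_point
    (convex_closedConvexHull (𝕜 := ℝ) (s := cylinders d)) isClosed_closedConvexHull hnot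
  obtain ⟨y, hy⟩ : ∃ y : E d, ∀ v : E d, f (v, 0) = inner ℝ v y := by
    refine ⟨(InnerProductSpace.toDual ℝ (E d)).symm (f.comp (ContinuousLinearMap.inl ℝ (E d) ℝ)),
      fun v => ?_⟩
    rw [real_inner_comm, InnerProductSpace.toDual_symm_apply]
    rfl
  set a : ℝ := f (0, 1) with ha
  have hfa (v : E d) (s : ℝ) : f (v, s) = inner ℝ v y + s * a := by
    have : (v, s) = (v, (0 : ℝ)) + s • ((0 : E d), (1 : ℝ)) := by simp
    rw [this, map_add, map_smul, hy, smul_eq_mul]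
  have hcyl {l : ℕ} (hl : l ≤ d) {s : ℝ} (hs : (l : ℝ) ≤ s) : gaugeNorm l y + s * a < u := by
    obtain ⟨v, hv, hvy⟩ := exists_mem_supportBall_inner_eq_gaugeNorm l y
    have := hf _ (subset_closedConvexHull (mem_cylinders hl hv hs))
    rwa [hfa, hvy] at this
  rw [hfa] at hu
  have hconj := calL0_le_coe_iff.1 hxt
  dsimp only at hconj
  -- The cylinders are unbounded upwards: for `a > 0` the point `(0, u / a)` would already reach the
  -- value `u`.
  have ha0 : a ≤ 0 := by
    by_contra! hpos
    have hu0 : 0 < u := by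
      simpa [gaugeNorm_zero_left] using hcyl (Nat.zero_le d) (s := 0) (by simp)
    have h := hcyl (Nat.zero_le d) (s := u / a) (by simpa using (div_pos hu0 hpos).le)
    rw [gaugeNorm_zero_left, div_mul_cancel₀ _ hpos.ne'] at h
    linarith
  rcases ha0.eq_or_lt with h0 | hneg
  -- Vertical hyperplane: it separates `x` from the unit ball, so the conjugate's inequalities along
  -- the ray through `y` are unbounded, contradicting the bound `t`.
  · have hlt : ‖y‖ < inner ℝ x y := by
      have h := hcyl le_rfl (le_refl (d : ℝ))
      rw [gaugeNorm_self] at h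
      rw [h0] at h hu
      linarith
    have hr (r : ℝ) (hr : 0 ≤ r) : r * (inner ℝ x y - ‖y‖) ≤ t := by
      have h := hconj (r • y)
      have h' := penalizedGauge_le_norm (r • y)
      rw [norm_smul, Real.norm_of_nonneg hr] at h'
      rw [real_inner_smul_right] at h
      linarith
    have hδ : 0 < inner ℝ x y - ‖y‖ := sub_pos.2 hlt
    have h := hr ((|t| + 1) / (inner ℝ x y - ‖y‖)) (by positivity)
    rw [div_mul_cancel₀ _ hδ.ne'] at h
    linarith [le_abs_self t]
  -- Rescaled to slope -1, the separation reads `penalizedGauge (c • y) ≤ c * u < c * inner ℝ x y -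
  -- t`, against the conjugate's inequality at `c • y`.
  · set c : ℝ := (-a)⁻¹ with hc
    have hcpos : 0 < c := inv_pos.2 (neg_pos.2 hneg)
    have hca : c * a = -1 := by
      rw [hc, inv_neg, neg_mul, inv_mul_cancel₀ hneg.ne]
    have hpen : penalizedGauge (c • y) ≤ c * u := by
      refine penalizedGauge_le fun l hl => ?_
      have h := mul_lt_mul_of_pos_left (hcyl hl (le_refl (l : ℝ))) hcpos
      have h' := gaugeNorm_smul_le l hcpos.le y
      have h'' : c * (gaugeNorm l y + l * a) = c * gaugeNorm l y - l := by
        linear_combination (l : ℝ) * hca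
      linarith
    have h := hconj (c • y)
    rw [real_inner_smul_right] at h
    have h' := mul_lt_mul_of_pos_left hu hcpos
    have h'' : c * (inner ℝ x y + t * a) = c * inner ℝ x y - t := by
      linear_combination t * hca
    linarith

theorem closedConvexHull_cylinders_subset :
    closedConvexHull ℝ (cylinders d) ⊆ decompositionEpigraph d :=
  closedConvexHull_min cylinders_subset_decompositionEpigraph convex_decompositionEpigraph
    isClosed_decompositionEpigraph

theorem epigraph_calL0_eq_closedConvexHull :
    epigraph (calL0 d) = closedConvexHull ℝ (cylinders d) :=
  epigraph_calL0_subset_closedConvexHull.antisymm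
    (closedConvexHull_cylinders_subset.trans decompositionEpigraph_subset_epigraph)

theorem epigraph_calL0_eq_decompositionEpigraph :
    epigraph (calL0 d) = decompositionEpigraph d :=
  (epigraph_calL0_subset_closedConvexHull.trans closedConvexHull_cylinders_subset).antisymm
    decompositionEpigraph_subset_epigraph

theorem exists_mem_decompositions_of_calL0_le {x : E d} {t : ℝ} (h : calL0 d x ≤ t) :
    ∃ z ∈ decompositions x, cost z ≤ t := by
  have hmem : (x, t) ∈ epigraph (calL0 d) := h
  rwa [epigraph_calL0_eq_decompositionEpigraph] at hmem

theorem calL0_le_cost {x : E d} {z : Fin d → E d} (hz : z ∈ decompositions x) :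
    calL0 d x ≤ cost z :=
  decompositionEpigraph_subset_epigraph (a := (x, cost z)) ⟨z, hz, le_rfl⟩

/-- A finite value `t` of `calL0` at `x` puts `(x, t)` itself in the epigraph, hence in
`decompositionEpigraph`, which supplies a minimizer. -/
theorem exists_calL0_eq_cost {x : E d} (h : calL0 d x < ⊤) :
    ∃ z ∈ decompositions x, calL0 d x = cost z := by
  have hbot : calL0 d x ≠ ⊥ := (EReal.bot_lt_zero.trans_le (calL0_nonneg x)).ne'
  have hcoe := EReal.coe_toReal h.ne hbot
  obtain ⟨z, hz, hzt⟩ := exists_mem_decompositions_of_calL0_le hcoe.ge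
  exact ⟨z, hz, (calL0_le_cost hz).antisymm (hcoe ▸ EReal.coe_le_coe_iff.2 hzt)⟩

theorem calL0_eq_sInf_cost (x : E d) :
    calL0 d x = sInf ((fun z => (cost z : EReal)) '' decompositions x) := by
  refine le_antisymm (le_sInf ?_) ?_
  · rintro _ ⟨z, hz, rfl⟩
    exact calL0_le_cost hz
  · rcases lt_or_eq_of_le (le_top : calL0 d x ≤ ⊤) with h | h
    · obtain ⟨z, hz, hzx⟩ := exists_calL0_eq_cost h
      exact hzx ▸ sInf_le ⟨z, hz, rfl⟩
    · exact h ▸ le_top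

/-! ### The step function and maximality -/

theorem stepL0_zero : stepL0 d 0 = 0 := by simp [stepL0]

theorem stepL0_of_mem_diff {l : ℕ} (hl : 1 ≤ l) (hld : l ≤ d) {x : E d}
    (hx : x ∈ supportBall d l \ supportBall d (l - 1)) : stepL0 d x = ((l : ℝ) : EReal) := by
  classical
  have hx0 : x ≠ 0 := by
    rintro rfl
    exact hx.2 (zero_mem_supportBall _)
  have h : ∃ l : ℕ, 1 ≤ l ∧ l ≤ d ∧ x ∈ supportBall d l \ supportBall d (l - 1) :=
    ⟨l, hl, hld, hx⟩
  have hfind : Nat.find h = l := by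
    refine le_antisymm (Nat.find_min' h ⟨hl, hld, hx⟩) ?_
    -- By nesting, membership in a smaller ball would put `x` in the ball of index `l - 1`.
    by_contra! hlt
    exact hx.2 (supportBall_mono (by omega) (Nat.find_spec h).2.2.1)
  simp only [stepL0, if_neg hx0, dif_pos h]
  rw [← hfind]

theorem stepL0_of_notMem (hd : 1 ≤ d) {x : E d} (hx : x ∉ Metric.closedBall (0 : E d) 1) :
    stepL0 d x = ⊤ := by
  have hx0 : x ≠ 0 := by
    rintro rfl
    simp at hx
  rw [stepL0, if_neg hx0, dif_neg]
  rintro ⟨l, -, hld, hxl, -⟩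
  exact hx (supportBall_self hd ▸ supportBall_mono hld hxl)

theorem stepL0_le_of_mem {l : ℕ} (hl : l ≤ d) {x : E d} (hx : x ∈ supportBall d l) :
    stepL0 d x ≤ ((l : ℝ) : EReal) := by
  induction l with
  | zero =>
    obtain rfl : x = 0 := by simpa [supportBall] using hx
    simp [stepL0_zero]
  | succ k ih =>
    by_cases hk : x ∈ supportBall d k
    · refine (ih (by omega) hk).trans (EReal.coe_le_coe_iff.2 ?_)
      push_cast
      linarith
    · exact (stepL0_of_mem_diff (by omega) hl ⟨hx, hk⟩).le

theorem calL0_le_of_mem {l : ℕ} (hl : l ≤ d) {x : E d} (hx : x ∈ supportBall d l) :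
    calL0 d x ≤ ((l : ℝ) : EReal) := by
  have h : (x, (l : ℝ)) ∈ epigraph (calL0 d) :=
    decompositionEpigraph_subset_epigraph
      (cylinders_subset_decompositionEpigraph (mem_cylinders hl hx le_rfl))
  exact h

theorem calL0_le_stepL0 : calL0 d ≤ stepL0 d := by
  classical
  intro x
  by_cases hx0 : x = 0
  · subst hx0
    rw [stepL0_zero]
    simpa using calL0_le_of_mem (Nat.zero_le d) (zero_mem_supportBall 0)
  by_cases h : ∃ l : ℕ, 1 ≤ l ∧ l ≤ d ∧ x ∈ supportBall d l \ supportBall d (l - 1)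
  · obtain ⟨l, hl, hld, hx⟩ := h
    rw [stepL0_of_mem_diff hl hld hx]
    exact calL0_le_of_mem hld hx.1
  · rw [stepL0, if_neg hx0, dif_neg h]
    exact le_top

theorem isProperConvexLsc_calL0 : IsProperConvexLsc (calL0 d) := by
  refine ⟨⟨fun x => EReal.bot_lt_zero.trans_le (calL0_nonneg x), 0, ?_⟩, ?_,
    lowerSemicontinuous_calL0⟩
  · exact (calL0_le_of_mem (Nat.zero_le d) (zero_mem_supportBall 0)).trans_lt
      (EReal.coe_lt_top _)
  · rw [epigraph_calL0_eq_decompositionEpigraph]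
    exact convex_decompositionEpigraph

theorem isClosed_epigraph {f : E d → EReal} (hf : LowerSemicontinuous f) :
    IsClosed (epigraph f) :=
  hf.isClosed_epigraph.preimage
    (f := fun p : E d × ℝ => (p.1, (p.2 : EReal)))
    (continuous_fst.prodMk (continuous_coe_real_ereal.comp continuous_snd))

/-- The epigraph of `f` is closed, convex and contains the cylinders, hence contains their closed
convex hull. -/
theorem le_calL0 {f : E d → EReal} (hf : IsProperConvexLsc f) (hle : f ≤ stepL0 d) :
    f ≤ calL0 d := by
  have hcyl : cylinders d ⊆ epigraph f := by
    rintro ⟨x, t⟩ hp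
    obtain ⟨l, hx, ht⟩ := Set.mem_iUnion.1 hp
    exact (hle x).trans ((stepL0_le_of_mem (Nat.le_of_lt_succ l.2) hx).trans
      (EReal.coe_le_coe_iff.2 ht))
  have hsub : epigraph (calL0 d) ⊆ epigraph f :=
    epigraph_calL0_subset_closedConvexHull.trans
      (closedConvexHull_min hcyl hf.2.1 (isClosed_epigraph hf.2.2))
  intro x
  rcases lt_or_eq_of_le (le_top : calL0 d x ≤ ⊤) with h | h
  · obtain ⟨z, -, hzx⟩ := exists_calL0_eq_cost h
    rw [hzx]
    exact hsub (a := (x, cost z)) hzx.le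
  · exact h ▸ le_top

end Capra

theorem mainTheorem3 (d : ℕ) (hd : 1 ≤ d) :
    -- the chain of unit balls
    ((∀ l : ℕ, 1 ≤ l → l ≤ d → Capra.supportBall d (l - 1) ⊆ Capra.supportBall d l) ∧
      Capra.supportBall d d = Metric.closedBall (0 : Capra.E d) 1) ∧
    -- the epigraph of `𝓛₀`
    Capra.epigraph (Capra.calL0 d) =
      closedConvexHull ℝ
        (⋃ l : Fin (d + 1), Capra.supportBall d (l : ℕ) ×ˢ Set.Ici (((l : ℕ) : ℝ))) ∧
    -- the function `L₀` takes the prescribed values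
    (Capra.stepL0 d 0 = 0 ∧
      (∀ l : ℕ, 1 ≤ l → l ≤ d →
        ∀ x ∈ Capra.supportBall d l \ Capra.supportBall d (l - 1),
          Capra.stepL0 d x = ((l : ℝ) : EReal)) ∧
      ∀ x ∉ Metric.closedBall (0 : Capra.E d) 1, Capra.stepL0 d x = ⊤) ∧
    -- `𝓛₀` is the largest proper convex lsc function below `L₀`
    IsGreatest {f : Capra.E d → EReal | Capra.IsProperConvexLsc f ∧ f ≤ Capra.stepL0 d}
      (Capra.calL0 d) ∧
    -- the minimum formula, the minimum over the empty set being `+∞`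
    ∀ x : Capra.E d,
      Capra.calL0 d x =
          sInf ((fun z => (Capra.cost z : EReal)) '' Capra.decompositions x) ∧
        ((Capra.decompositions x).Nonempty →
          ∃ z ∈ Capra.decompositions x, Capra.calL0 d x = (Capra.cost z : EReal)) := by
  refine ⟨⟨fun l _ _ => Capra.supportBall_mono (Nat.sub_le l 1), Capra.supportBall_self hd⟩,
    Capra.epigraph_calL0_eq_closedConvexHull,
    ⟨Capra.stepL0_zero, fun l hl hld x hx => Capra.stepL0_of_mem_diff hl hld hx,
      fun x hx => Capra.stepL0_of_notMem hd hx⟩,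
    ⟨⟨Capra.isProperConvexLsc_calL0, Capra.calL0_le_stepL0⟩, fun f hf => Capra.le_calL0 hf.1 hf.2⟩,
    fun x => ⟨Capra.calL0_eq_sInf_cost x, ?_⟩⟩
  rintro ⟨z, hz⟩
  exact Capra.exists_calL0_eq_cost ((Capra.calL0_le_cost hz).trans_lt (EReal.coe_lt_top _))
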